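/- All foliations are holomorphic, of codimension one, over $\mathbb C$. A foliation on $\mathbb P^n$ is given, up to a nonzero constant, by a form $\Omega=\sum_j A_j\,dz_j$ on $\mathbb C^{n+1}$ whose coefficients are homogeneous polynomials of the same degree, with $\sum_j z_jA_j=0$, $\Omega\wedge d\Omega=0$, and singular set $\{A_0=\dots=A_n=0\}$ of codimension at least $2$. Its degree is the number of tangencies, counted with multiplicities, of a generic line of $\mathbb P^n$ with the foliation. Let $n\ge 3$, $d\ge 2$, $\nu\ge 2$ and $1<\alpha<\beta<\gamma$ be integers. Let $F_0,F_1,F_2\in\mathbb C[z_0,\dots,z_n]$ be homogeneous polynomials without common factor, with $\alpha\deg F_0=\beta\deg F_1=\gamma\deg F_2=\nu$, let $\tilde f=(F_0^\alpha,F_1^\beta,F_2^\gamma):\mathbb C^{n+1}\to\mathbb C^3$, and let $f=(F_0^\alpha:F_1^\beta:F_2^\gamma):\mathbb P^n\dashrightarrow\mathbb P^2$. Let $\mathcal G$ be a foliation of degree $d$ on $\mathbb P^2$. Assume that $(f,\mathcal G)$ is a generic pair, that is: 1. $dF_0\wedge dF_1\wedge dF_2\neq 0$ at every point $p\ne 0$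 of $\mathbb C^{n+1}$ with $\tilde f(p)=0$; 2. every singularity of $\mathcal G$ is hyperbolic: near it some holomorphic vector field tangent to $\mathcal G$ has nonsingular linear part there, and for any such field the quotient of the eigenvalues of this linear part is not real; 3. $\mathcal G$ leaves invariant three lines in general position, and these are its only invariant irreducible algebraic curves; 4. the three coordinate lines of $\mathbb P^2$ are $\mathcal G$-invariant; 5. no singularity of $\mathcal G$ is of the form $[\tilde f(w)]$ with $w\in\mathbb C^{n+1}$, $\tilde f(w)\ne0$ and $(dF_0\wedge dF_1\wedge dF_2)(w)=0$. Let $\mathcal F=f^*\mathcal G$ be the pull-back foliation on $\mathbb P^n$: if $\omega$ is a form defining $\mathcal G$, then $\mathcal F$ is the foliation defined by a form $\eta$ with $\tilde f^*\omega=h\,\eta$ for some nonzero polynomial $h$. Then $$\deg\mathcal F=\nu\left[(d-1)+\frac1\alpha+\frac1\beta+\frac1\gamma\right]-2 .$$ -/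

import Mathlib

open scoped Topology

/-- Coefficients `A₀, …, Aₙ` of a polynomial 1-form `∑ Aⱼ dzⱼ` on `ℂⁿ⁺¹`. -/
abbrev PolyForm (n : ℕ) : Type := Fin (n + 1) → MvPolynomial (Fin (n + 1)) ℂ

/-- The affine cone `{A₀ = ⋯ = Aₙ = 0}` of zeros of a polynomial 1-form. -/
def PolyForm.zeroSet {n : ℕ} (ω : PolyForm n) : Set (Fin (n + 1) → ℂ) :=
  {z | ∀ j, MvPolynomial.eval z (ω j) = 0}

/-- A codimension one holomorphic foliation on `ℙⁿ`, given by a homogeneous expression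
`∑ Aⱼ dzⱼ`. -/
structure Foliation (n : ℕ) where
  form : PolyForm n
  /-- the coefficients are homogeneous of the same degree -/
  homogeneous : ∃ m : ℕ, ∀ j, (form j).IsHomogeneous m
  /-- the Euler condition `∑ zⱼ Aⱼ = 0` -/
  euler : ∑ j, MvPolynomial.X j * form j = 0
  /-- the integrability condition `Ω ∧ dΩ = 0`, in coordinates -/
  integrable : ∀ i j k,
    form i * (MvPolynomial.pderiv j (form k) - MvPolynomial.pderiv k (form j))
      + form j * (MvPolynomial.pderiv k (form i) - MvPolynomial.pderiv i (form k))
      + form k * (MvPolynomial.pderiv i (form j) - MvPolynomial.pderiv j (form i)) = 0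
  /-- the singular set has codimension at least two: it contains no hypersurface (and, with
  `P = 0`, it is not the whole space) -/
  codim_two : ∀ P : MvPolynomial (Fin (n + 1)) ℂ, ¬ IsUnit P →
    ¬ ({z | MvPolynomial.eval z P = 0} ⊆ form.zeroSet)

/-- Order of contact at `p` of a 1-form with the line through the independent points `p`, `q`:
the vanishing order at `t = 0` of the form along `t ↦ p + t q`, applied to the velocity `q`
(it is `⊤` if the line is invariant). -/
noncomputable def PolyForm.tangencyOrder {n : ℕ} (ω : PolyForm n) (p q : Fin (n + 1) → ℂ) : ℕ∞ :=
  emultiplicity (Polynomial.X : Polynomial ℂ)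
    (∑ j, MvPolynomial.aeval
        (fun i => Polynomial.C (p i) + Polynomial.C (q i) * Polynomial.X) (ω j)
      * Polynomial.C (q j))

/-- The line through `a` and `b`, whose points are `[b]` and the `[a + t b]` with `t ∈ ℂ`, has
finitely many tangencies with the form, and `k` of them counted with multiplicities. -/
def PolyForm.TangencyCount {n : ℕ} (ω : PolyForm n) (a b : Fin (n + 1) → ℂ) (k : ℕ) : Prop :=
  {t : ℂ | ω.tangencyOrder (a + t • b) b ≠ 0}.Finite ∧
    ω.tangencyOrder b a + ∑ᶠ t : ℂ, ω.tangencyOrder (a + t • b) b = (k : ℕ∞)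

/-- The foliation has degree `k`: a generic line, that is, the line through `a` and `b` for all
`(a, b)` in a nonempty Zariski open set, has `k` tangencies with it counted with multiplicities. -/
def Foliation.HasDegree {n : ℕ} (F : Foliation n) (k : ℕ) : Prop :=
  ∃ Q : MvPolynomial (Fin (n + 1) ⊕ Fin (n + 1)) ℂ, Q ≠ 0 ∧
    ∀ a b : Fin (n + 1) → ℂ, LinearIndependent ℂ ![a, b] →
      MvPolynomial.eval (Sum.elim a b) Q ≠ 0 → F.form.TangencyCount a b k

/-- The singular set of a foliation as a subset of `ℙⁿ`. -/
def Foliation.sing {n : ℕ} (F : Foliation n) : Set (Projectivization ℂ (Fin (n + 1) → ℂ)) :=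
  {y | y.rep ∈ F.form.zeroSet}

/-- `P = 0` is an irreducible algebraic curve (in general, hypersurface) invariant by the
foliation: `P` divides `Ω ∧ dP`. -/
def Foliation.IsInvariant {n : ℕ} (G : Foliation n) (P : MvPolynomial (Fin (n + 1)) ℂ) : Prop :=
  Irreducible P ∧ (∃ m : ℕ, P.IsHomogeneous m) ∧
    ∀ i j, P ∣ G.form i * MvPolynomial.pderiv j P - G.form j * MvPolynomial.pderiv i P

/-- The point with coordinates `x` in the affine chart `z_k = 1` of `ℙ²`. -/
def chartPoint (k : Fin 3) (x : Fin 2 → ℂ) : Fin 3 → ℂ :=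
  Fin.insertNth (α := fun _ => ℂ) k 1 x

/-- `V` is a holomorphic vector field near `q`, in the chart `z_k = 1` of `ℙ²`, tangent to the
foliation. -/
def Foliation.IsTangentField (G : Foliation 2) (k : Fin 3) (q : Fin 2 → ℂ)
    (V : (Fin 2 → ℂ) → (Fin 2 → ℂ)) : Prop :=
  AnalyticAt ℂ V q ∧ ∀ᶠ x in 𝓝 q,
    ∑ i, MvPolynomial.eval (chartPoint k x) (G.form (k.succAbove i)) * V x i = 0

/-- `lam` is a characteristic number at the point `q` of the chart `z_k = 1`: a quotient of the
two eigenvalues of `DV(q)`, for a tangent field `V` with `DV(q)` nonsingular. -/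
def Foliation.IsCharNumber (G : Foliation 2) (k : Fin 3) (q : Fin 2 → ℂ) (lam : ℂ) : Prop :=
  ∃ V : (Fin 2 → ℂ) → (Fin 2 → ℂ), G.IsTangentField k q V ∧
    ∃ l₁ l₂ : ℂ, l₁ ≠ 0 ∧ l₂ ≠ 0 ∧
      (LinearMap.charpoly (fderiv ℂ V q : (Fin 2 → ℂ) →ₗ[ℂ] (Fin 2 → ℂ))).roots = {l₁, l₂} ∧
      lam = l₁ / l₂

/-- The point `q` of the chart `z_k = 1` is nondegenerate: some tangent field `V` has `DV(q)`
nonsingular. -/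
def Foliation.IsNondegenerate (G : Foliation 2) (k : Fin 3) (q : Fin 2 → ℂ) : Prop :=
  ∃ V : (Fin 2 → ℂ) → (Fin 2 → ℂ), G.IsTangentField k q V ∧
    Function.Bijective (fderiv ℂ V q)

/-- All singularities are nondegenerate, with nonreal characteristic numbers. -/
def Foliation.IsHyperbolic (G : Foliation 2) : Prop :=
  ∀ (k : Fin 3) (q : Fin 2 → ℂ), chartPoint k q ∈ G.form.zeroSet →
    G.IsNondegenerate k q ∧ ∀ lam : ℂ, G.IsCharNumber k q lam → lam.im ≠ 0

/-- The set `M(d)`: foliations of degree `d` on `ℙ²` with hyperbolic singularities and three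
invariant lines in general position, which are their only invariant algebraic curves. -/
structure Foliation.MemM (d : ℕ) (G : Foliation 2) : Prop where
  degree : G.HasDegree d
  hyperbolic : G.IsHyperbolic
  lines : ∃ L : Fin 3 → MvPolynomial (Fin 3) ℂ,
    (∀ i, (L i).IsHomogeneous 1) ∧ LinearIndependent ℂ L ∧ (∀ i, G.IsInvariant (L i)) ∧
      ∀ P, G.IsInvariant P → ∃ i, Associated P (L i)

/-- The lift `(F₀^α, F₁^β, F₂^γ)` of the rational map `(F₀^α : F₁^β : F₂^γ)`. -/
noncomputable def branchedLift {n : ℕ} (α β γ : ℕ) (F : Fin 3 → MvPolynomial (Fin (n + 1)) ℂ) :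
    Fin 3 → MvPolynomial (Fin (n + 1)) ℂ :=
  ![F 0 ^ α, F 1 ^ β, F 2 ^ γ]

/-- The value of the lift at a point of `ℂⁿ⁺¹`. -/
noncomputable def branchedValue {n : ℕ} (α β γ : ℕ) (F : Fin 3 → MvPolynomial (Fin (n + 1)) ℂ)
    (w : Fin (n + 1) → ℂ) : Fin 3 → ℂ :=
  fun i => MvPolynomial.eval w (branchedLift α β γ F i)

/-- `dF₀ ∧ dF₁ ∧ dF₂ ≠ 0` at `w`. -/
def IndepDifferentials {n : ℕ} (F : Fin 3 → MvPolynomial (Fin (n + 1)) ℂ)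
    (w : Fin (n + 1) → ℂ) : Prop :=
  LinearIndependent ℂ
    (fun (i : Fin 3) (j : Fin (n + 1)) => MvPolynomial.eval w (MvPolynomial.pderiv j (F i)))

/-- `(F₀^α : F₁^β : F₂^γ)` is a branched rational map of degree `ν`. -/
structure IsBRM (n ν α β γ : ℕ) (F : Fin 3 → MvPolynomial (Fin (n + 1)) ℂ) : Prop where
  two_le : 2 ≤ ν
  one_lt : 1 < α
  lt₁ : α < β
  lt₂ : β < γ
  homogeneous : ∀ i, (F i).IsHomogeneous (F i).totalDegree
  degree₀ : (F 0).totalDegree * α = ν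
  degree₁ : (F 1).totalDegree * β = ν
  degree₂ : (F 2).totalDegree * γ = ν
  no_common_factor : ∀ h, (∀ i, h ∣ F i) → IsUnit h

/-- The generic branched rational maps. -/
structure IsGenericBRM (n ν α β γ : ℕ) (F : Fin 3 → MvPolynomial (Fin (n + 1)) ℂ) : Prop where
  brm : IsBRM n ν α β γ F
  transverse : ∀ p, p ≠ 0 → branchedValue α β γ F p = 0 → IndepDifferentials F p

/-- The set `Y₂(f) ⊆ ℙ²`: the image of the points where `dF₀ ∧ dF₁ ∧ dF₂ = 0`. -/
def criticalImage {n : ℕ} (α β γ : ℕ) (F : Fin 3 → MvPolynomial (Fin (n + 1)) ℂ) :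
    Set (Projectivization ℂ (Fin 3 → ℂ)) :=
  {y | ∃ (w : Fin (n + 1) → ℂ) (hw : branchedValue α β γ F w ≠ 0),
    ¬ IndepDifferentials F w ∧ y = Projectivization.mk ℂ (branchedValue α β γ F w) hw}

/-- `(f, 𝒢)` is a generic pair, where `f = (F₀^α : F₁^β : F₂^γ)`. -/
structure IsGenericPair (n ν α β γ d : ℕ) (F : Fin 3 → MvPolynomial (Fin (n + 1)) ℂ)
    (G : Foliation 2) : Prop where
  generic : IsGenericBRM n ν α β γ F
  memM : G.MemM d
  coord_lines : ∀ i : Fin 3, G.IsInvariant (MvPolynomial.X i)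
  sing_disjoint : G.sing ∩ criticalImage α β γ F = ∅

/-- The pull-back of a polynomial 1-form on `ℂ³` by a polynomial map `Φ : ℂⁿ⁺¹ → ℂ³`. -/
noncomputable def PolyForm.pullback {n : ℕ} (ω : PolyForm 2)
    (Φ : Fin 3 → MvPolynomial (Fin (n + 1)) ℂ) : PolyForm n :=
  fun j => ∑ i, MvPolynomial.bind₁ Φ (ω i) * MvPolynomial.pderiv j (Φ i)

/-- `ℱ` is the pull-back foliation `f^*𝒢`: the pull-back of a form of `𝒢` by the lift of `f` is
not zero and is a polynomial multiple of the form of `ℱ` (the extra factor being the divisor of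
zeros of the pulled-back form). -/
def Foliation.IsPullback {n : ℕ} (𝓕 : Foliation n) (α β γ : ℕ)
    (F : Fin 3 → MvPolynomial (Fin (n + 1)) ℂ) (G : Foliation 2) : Prop :=
  ∃ h : MvPolynomial (Fin (n + 1)) ℂ, h ≠ 0 ∧
    ∀ j, G.form.pullback (branchedLift α β γ F) j = h * 𝓕.form j

/-! By homogeneity and the Euler relation, a foliation with coefficients of degree `k + 1` has
degree `k`: the form along a line is a polynomial in `t` whose zeros, with the contact at infinity,
total `k`. It remains to find the exact common factor of the pulled-back form, whose coefficients
have degree `ν(d+1) + ν - 1`. Write `e = (α, β, γ)`. Since the coordinate lines are invariant, `ω =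
x₀x₁x₂ ∑ Bᵢ dxᵢ/xᵢ`, so `∏ Fᵢ ^ (eᵢ - 1)`, of degree `∑ (ν - deg Fᵢ)`, divides the pull-back. The
point is that nothing more does (`IsGenericPair.exists_pullback_eq`). Suppose an irreducible `P`
divides the quotient. It vanishes at the origin, and as `n + 1 > 3`, Krull's height theorem gives `w
≠ 0` with `P = F₀ = F₁ = 0`. Either `w` is over the base locus, or it maps to the singularity
`(0:0:1)`; in both cases genericity makes the `dFᵢ` independent at `w`, hence independent modulo
`P`. So `P` divides every coefficient of the quotient in the `dFᵢ`, and `P = 0` maps into the zeros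
of `ω`. These are finitely many lines through the origin, so the `Fᵢ ^ eᵢ` are proportional over `ℂ`
on `P = 0`. This yields two functions vanishing there with independent differentials, which is
impossible on a hypersurface (`exists_not_dvd_aeval_pow`). -/

namespace MvPolynomial

/-! ### Common zeros of few polynomials, by heights -/

/-- The specialization of the first `k` variables to zero. -/
noncomputable def killVars (n k : ℕ) :
    MvPolynomial (Fin n) ℂ →ₐ[ℂ] MvPolynomial (Fin n) ℂ :=
  aeval fun i => if (i : ℕ) < k then 0 else X i

/-- These kernels form a chain of primes, strict because the next variable enters at each step. -/
theorem le_height_ker_killVars (n k : ℕ) (hk : k ≤ n) :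
    (k : ℕ∞) ≤ (RingHom.ker (killVars n k)).height := by
  induction k with
  | zero => simp
  | succ k ih =>
    have h1 := ih (by omega)
    have hp : ∀ k, (RingHom.ker (killVars n k)).IsPrime := fun k => RingHom.ker_isPrime _
    have hlt : RingHom.ker (killVars n k) < RingHom.ker (killVars n (k + 1)) := by
      have hcomp : killVars n (k + 1) = (killVars n (k + 1)).comp (killVars n k) := by
        ext1 i
        by_cases hi : (i : ℕ) < k
        · simp [killVars, hi, hi.le]
        · simp [killVars, hi]
      refine lt_of_le_of_ne (fun p hp => ?_) fun h => ?_
      · rw [RingHom.mem_ker] at hp ⊢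
        rw [hcomp, AlgHom.comp_apply, hp, map_zero]
      · have : X ⟨k, hk⟩ ∈ RingHom.ker (killVars n k) := by
          rw [h]; simp [killVars]
        simp [killVars] at this
    have := hp k
    have := hp (k + 1)
    calc ((k + 1 : ℕ) : ℕ∞) = (k : ℕ∞) + 1 := by push_cast; rfl
      _ ≤ _ := by gcongr
      _ ≤ _ := Ideal.height_add_one_le_of_lt_of_isPrime hlt

theorem le_height_vanishingIdeal_zero (n : ℕ) :
    (n : ℕ∞) ≤ (vanishingIdeal ℂ {(0 : Fin n → ℂ)}).height := by
  refine (le_height_ker_killVars n n le_rfl).trans (Ideal.height_mono fun p hp => ?_)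
  have : (aeval (0 : Fin n → ℂ)).comp (killVars n n) = aeval (R := ℂ) (0 : Fin n → ℂ) := by
    ext1 i; simp [killVars]
  rw [mem_vanishingIdeal_singleton_iff, ← this, AlgHom.comp_apply, (RingHom.mem_ker).1 hp, map_zero]

/-- Fewer than `n` polynomials in `n` variables that vanish at the origin have another common
zero. -/
theorem exists_ne_zero_forall_eval_eq_zero {n : ℕ} (s : Set (MvPolynomial (Fin n) ℂ))
    (hs : s.Finite) (hcard : s.ncard < n) (h0 : ∀ p ∈ s, eval 0 p = 0) :
    ∃ w : Fin n → ℂ, w ≠ 0 ∧ ∀ p ∈ s, eval w p = 0 := by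
  by_contra! hcon
  -- If the origin were the only common zero, the Nullstellensatz would make its maximal ideal
  -- minimal over `s`, against Krull's bound on the height.
  have hmem : vanishingIdeal ℂ {(0 : Fin n → ℂ)} ∈ (Ideal.span s).minimalPrimes := by
    refine ⟨⟨inferInstance, Ideal.span_le.2 fun p hp => ?_⟩, fun J hJ _ => ?_⟩
    · simpa [aeval_eq_eval] using h0 p hp
    · have h1 : vanishingIdeal ℂ {(0 : Fin n → ℂ)} ≤ (Ideal.span s).radical := by
        rw [← vanishingIdeal_zeroLocus_eq_radical (K := ℂ)]
        refine vanishingIdeal_anti_mono fun x hx => ?_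
        by_contra hx0
        obtain ⟨p, hp, hpx⟩ := hcon x hx0
        exact hpx (by simpa [aeval_eq_eval] using hx p (Ideal.subset_span hp))
      have := hJ.1
      exact h1.trans ((Ideal.radical_mono hJ.2).trans hJ.1.radical.le)
  have := Ideal.height_le_card_of_mem_minimalPrimes_span hs hmem
  have := (le_height_vanishingIdeal_zero n).trans this
  exact absurd (by exact_mod_cast this) hcard.not_ge

/-! ### Scaling and divisors of homogeneous polynomials -/

theorem IsHomogeneous.aeval_mul_left {σ R S : Type*} [CommSemiring R] [CommSemiring S]
    [Algebra R S] {p : MvPolynomial σ R} {m : ℕ} (hp : p.IsHomogeneous m) (c : S) (g : σ → S) :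
    MvPolynomial.aeval (fun i => c * g i) p = c ^ m * MvPolynomial.aeval g p := by
  simp only [aeval_def, eval₂_eq, Finset.mul_sum]
  refine Finset.sum_congr rfl fun d hd => ?_
  have hdeg : ∑ i ∈ d.support, d i = m := by
    simpa [Finsupp.weight_apply, Finsupp.sum] using hp (mem_support_iff.1 hd)
  simp only [mul_pow, Finset.prod_mul_distrib, Finset.prod_pow_eq_pow_sum, hdeg]
  ring

theorem IsHomogeneous.eval_smul {σ R : Type*} [CommSemiring R] {p : MvPolynomial σ R} {m : ℕ}
    (hp : p.IsHomogeneous m) (c : R) (z : σ → R) : eval (c • z) p = c ^ m * eval z p := by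
  have := hp.aeval_mul_left c z
  rwa [aeval_eq_eval] at this

/-- A divisor of a homogeneous polynomial that does not vanish at the origin is constant. -/
theorem eq_C_of_dvd_isHomogeneous {σ : Type*} {P G : MvPolynomial σ ℂ} {N : ℕ}
    (hG : G.IsHomogeneous N) (hG0 : G ≠ 0) (hPG : P ∣ G) (hP : eval 0 P ≠ 0) :
    P = C (eval 0 P) := by
  -- The factor `G` reduces the claim to points where `G` does not vanish.
  suffices (P - C (eval 0 P)) * G = 0 by
    rcases mul_eq_zero.1 this with h | h
    · exact sub_eq_zero.1 h
    · exact absurd h hG0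
  refine MvPolynomial.funext fun z => ?_
  simp only [map_mul, map_sub, eval_C, map_zero, mul_eq_zero, sub_eq_zero]
  by_cases hz : eval z G = 0
  · exact Or.inr hz
  left
  -- Restriction to the line `t ↦ t z`: there `G` is a constant times `t ^ N`, so `P` is a constant
  -- times `t ^ e`, and `P(0) ≠ 0` forces `e = 0`.
  let φ : MvPolynomial σ ℂ →ₐ[ℂ] Polynomial ℂ :=
    aeval fun i => Polynomial.X * Polynomial.C (z i)
  have hev : ∀ (t : ℂ) (p : MvPolynomial σ ℂ), (φ p).eval t = eval (t • z) p := by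
    intro t p
    have : (Polynomial.aeval t).comp φ = aeval (R := ℂ) (t • z) := by
      ext1 i; simp [φ, mul_comm t]
    have := DFunLike.congr_fun this p
    rwa [aeval_eq_eval, AlgHom.comp_apply, Polynomial.coe_aeval_eq_eval] at this
  have hφG : φ G = Polynomial.X ^ N * Polynomial.C (eval z G) := by
    refine Polynomial.funext fun t => ?_
    rw [hev, hG.eval_smul]
    simp [mul_comm (t ^ N)]
  have hdvd : φ P ∣ Polynomial.X ^ N := by
    have := hφG ▸ map_dvd φ hPG
    exact (Polynomial.isUnit_C.2 (isUnit_iff_ne_zero.2 hz)).dvd_mul_right.1 this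
  obtain ⟨e, -, he⟩ := (dvd_prime_pow Polynomial.prime_X N).1 hdvd
  obtain ⟨u, hu⟩ := he.symm
  have h0 := hev 0 P
  have he0 : e = 0 := by
    by_contra he
    rw [← hu] at h0
    rw [zero_smul, Polynomial.eval_mul, Polynomial.eval_pow, Polynomial.eval_X, zero_pow he,
      zero_mul] at h0
    exact hP h0.symm
  subst he0
  obtain ⟨c, -, hc⟩ := Polynomial.isUnit_iff.1 u.isUnit
  have h1 := hev 1 P
  rw [← hu, ← hc] at h0 h1
  rw [pow_zero, one_mul, Polynomial.eval_C] at h0 h1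
  rw [← zero_smul ℂ z, ← h0, h1, one_smul]

end MvPolynomial

/-! ### Algebraic dependence of the coordinates of a zero -/

open Polynomial in
/-- Gauss: over a unique factorization domain `S` that embeds into the domain `K`, an irreducible
polynomial divides every polynomial with which it has a common zero in `K`. -/
theorem Irreducible.dvd_of_aeval_eq_zero {S K : Type*} [CommRing S] [IsDomain S]
    [UniqueFactorizationMonoid S] [Field K] [Algebra S K]
    (hinj : Function.Injective (algebraMap S K)) {Q B : S[X]} (hQ : Irreducible Q) {y : K}
    (hQy : aeval y Q = 0) (hBy : aeval y B = 0) : Q ∣ B := by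
  have : FaithfulSMul S K := (faithfulSMul_iff_algebraMap_injective S K).2 hinj
  let L := FractionRing S
  let : Algebra L K := FractionRing.liftAlgebra S K
  have : IsScalarTower S L K := inferInstance
  have hdeg : Q.natDegree ≠ 0 := by
    intro h
    rw [Polynomial.natDegree_eq_zero] at h
    obtain ⟨c, rfl⟩ := h
    rw [aeval_C, map_eq_zero_iff _ hinj] at hQy
    exact hQ.ne_zero (by rw [hQy, C_0])
  have hprim : Q.IsPrimitive := hQ.isPrimitive hdeg
  have hirr := (hprim.irreducible_iff_irreducible_map_fraction_map (K := L)).1 hQ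
  refine hprim.dvd_of_fraction_map_dvd_fraction_map (K := L) ?_
  -- Over the fraction field `Q` stays irreducible, so it is the minimal polynomial of `y` up to a
  -- unit.
  have h1 : minpoly L y ∣ Q.map (algebraMap S L) := minpoly.dvd _ _ (by rwa [aeval_map_algebraMap])
  have h2 : minpoly L y ∣ B.map (algebraMap S L) := minpoly.dvd _ _ (by rwa [aeval_map_algebraMap])
  have hint : IsIntegral L y := by
    refine isAlgebraic_iff_isIntegral.1 ⟨Q.map (algebraMap S L), hirr.ne_zero, ?_⟩
    rwa [aeval_map_algebraMap]
  exact ((minpoly.irreducible hint).associated_of_dvd hirr h1).symm.dvd.trans h2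

namespace MvPolynomial

/-- If polynomials without common irreducible factor vanish at `(y₀, …, yₘ)`, then `y₁, …, yₘ` are
algebraically dependent. -/
theorem not_algebraicIndependent_of_zero_succ {ι k K : Type*} [Field k] [Field K] [Algebra k K]
    {m : ℕ} (A : ι → MvPolynomial (Fin (m + 1)) k)
    (hA : ∀ Q, Irreducible Q → ∃ i, ¬ Q ∣ A i)
    (y : Fin (m + 1) → K) (hy : ∀ i, aeval y (A i) = 0) :
    ¬ AlgebraicIndependent k fun i : Fin m => y i.succ := by
  intro hind
  have hA0 : ∃ i, A i ≠ 0 := by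
    obtain ⟨i, hi⟩ := hA (X 0) (X_prime.irreducible)
    exact ⟨i, fun h => hi (h ▸ dvd_zero _)⟩
  obtain ⟨i, hi⟩ := hA0
  -- The kernel of evaluation at `y` is prime, so it contains an irreducible factor of `A i`.
  obtain ⟨Q, hQ, hQy, -⟩ : ∃ Q, Irreducible Q ∧ aeval y Q = 0 ∧ Q ∣ A i := by
    have hp : (RingHom.ker (aeval (R := k) y)).IsPrime := RingHom.ker_isPrime _
    have h1 : A i ∈ RingHom.ker (aeval (R := k) y) := hy i
    obtain ⟨u, hu⟩ := UniqueFactorizationMonoid.factors_prod hi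
    have h2 : (UniqueFactorizationMonoid.factors (A i)).prod ∈ RingHom.ker (aeval (R := k) y) := by
      rw [← hu] at h1
      exact (hp.mem_or_mem h1).resolve_right fun h => hp.ne_top (Ideal.eq_top_of_isUnit_mem _ h u.isUnit)
    obtain ⟨Q, hQ, hQm⟩ := (hp.multiset_prod_mem_iff_exists_mem _).1 h2
    exact ⟨Q, UniqueFactorizationMonoid.irreducible_of_factor Q hQ, hQm,
      UniqueFactorizationMonoid.dvd_of_mem_factors hQ⟩
  obtain ⟨j, hj⟩ := hA Q hQ
  refine hj ?_
  -- Independence of the last `m` coordinates embeds their polynomial ring in `K`; Gauss's lemma in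
  -- the variable `X 0` then makes `Q` divide every `A j`.
  let : Algebra (MvPolynomial (Fin m) k) K :=
    (aeval fun i : Fin m => y i.succ).toRingHom.toAlgebra
  have hinj : Function.Injective (algebraMap (MvPolynomial (Fin m) k) K) := hind
  have hev : ∀ p : MvPolynomial (Fin (m + 1)) k,
      Polynomial.aeval (y 0) (finSuccEquiv k m p) = aeval y p := by
    intro p
    induction p using MvPolynomial.induction_on with
    | C a =>
      rw [finSuccEquiv_apply, eval₂Hom_C, RingHom.comp_apply, Polynomial.aeval_C, aeval_C]
      exact aeval_C _ a
    | add p q hp hq => simp only [map_add, hp, hq]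
    | mul_X p i hp =>
      rw [map_mul, map_mul, map_mul, hp]
      congr 1
      refine Fin.cases ?_ (fun i => ?_) i
      · rw [finSuccEquiv_X_zero, Polynomial.aeval_X, aeval_X]
      · rw [finSuccEquiv_X_succ, Polynomial.aeval_C, aeval_X]
        exact aeval_X _ i
  have := Irreducible.dvd_of_aeval_eq_zero hinj
    ((MulEquiv.irreducible_iff (finSuccEquiv k m).toMulEquiv).2 hQ)
    ((hev Q).trans hQy) ((hev (A j)).trans (hy j))
  exact (map_dvd_iff (finSuccEquiv k m)).1 this

theorem not_algebraicIndependent_of_zero {ι k K : Type*} [Field k] [Field K] [Algebra k K]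
    {m : ℕ} (A : ι → MvPolynomial (Fin (m + 1)) k)
    (hA : ∀ Q, Irreducible Q → ∃ i, ¬ Q ∣ A i)
    (y : Fin (m + 1) → K) (hy : ∀ i, aeval y (A i) = 0) (σ : Equiv.Perm (Fin (m + 1))) :
    ¬ AlgebraicIndependent k fun i : Fin m => y (σ i.succ) := by
  refine not_algebraicIndependent_of_zero_succ (fun i => renameEquiv k σ.symm (A i))
    (fun Q hQ => ?_) (y ∘ σ) (fun i => ?_)
  · obtain ⟨i, hi⟩ := hA (renameEquiv k σ Q) ((MulEquiv.irreducible_iff (renameEquiv k σ).toMulEquiv).2 hQ)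
    refine ⟨i, fun h => hi ?_⟩
    have := map_dvd (renameEquiv k σ) h
    simpa [rename_rename] using this
  · rw [renameEquiv_apply, aeval_rename]
    simpa [Function.comp_assoc] using hy i

/-- If a polynomial vanishes at `y T`, with `T` an indeterminate, then its homogeneous components
vanish at `y`. -/
theorem aeval_homogeneousComponent_eq_zero {σ k D : Type*} [CommRing k] [CommRing D] [Algebra k D]
    (y : σ → D) (R : MvPolynomial σ k)
    (h : aeval (fun i => Polynomial.X * Polynomial.C (y i)) R = 0) (j : ℕ) :
    aeval y (homogeneousComponent j R) = 0 := by
  have hC : ∀ p : MvPolynomial σ k, aeval (fun i => Polynomial.C (y i)) p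
      = Polynomial.C (aeval y p) := fun p => by
    have : aeval (fun i => Polynomial.C (y i)) = (Polynomial.CAlgHom (R := k) (A := D)).comp (aeval y) := by
      ext1 i; simp
    rw [this]; rfl
  have h2 : aeval (fun i => Polynomial.X * Polynomial.C (y i)) R = ∑ i ∈ Finset.range (R.totalDegree + 1),
      Polynomial.X ^ i * Polynomial.C (aeval y (homogeneousComponent i R)) := by
    conv_lhs => rw [← sum_homogeneousComponent R, map_sum]
    exact Finset.sum_congr rfl fun i _ => by
      rw [(homogeneousComponent_isHomogeneous i R).aeval_mul_left, hC]
  by_cases hj : R.totalDegree < j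
  · rw [homogeneousComponent_eq_zero _ _ hj, map_zero]
  have h3 := congrArg (fun p => Polynomial.coeff p j) (h2.symm.trans h)
  simp only [Polynomial.X_pow_mul, Polynomial.C_mul_X_pow_eq_monomial, Polynomial.finsetSum_coeff,
    Polynomial.coeff_monomial, Finset.sum_ite_eq', Polynomial.coeff_zero] at h3
  rwa [if_pos (Finset.mem_range.2 (Nat.lt_succ_of_le (not_lt.1 hj)))] at h3

end MvPolynomial

/-! ### Hypersurfaces do not map into the zeros of a primitive form -/

namespace MvPolynomial

theorem exists_eval_ne_zero_of_isHomogeneous_two {H : MvPolynomial (Fin 2) ℂ} {j : ℕ}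
    (hH : H.IsHomogeneous j) (h0 : H ≠ 0) : ∃ x : ℂ, eval ![x, 1] H ≠ 0 := by
  by_contra! hcon
  have : X 1 * H = 0 := by
    refine MvPolynomial.funext fun z => ?_
    rw [map_mul, eval_X, map_zero]
    by_cases hz : z 1 = 0
    · rw [hz, zero_mul]
    · have : z = z 1 • ![z 0 / z 1, 1] := by
        ext i; fin_cases i <;> simp [hz, mul_div_cancel₀]
      rw [this, hH.eval_smul, hcon, mul_zero, mul_zero]
  exact h0 ((mul_eq_zero.1 this).resolve_left (X_ne_zero _))

/-- A zero, with coordinates in a domain over `ℂ`, of homogeneous polynomials in three variables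
without common irreducible factor is proportional to a point with coordinates in `ℂ`. -/
theorem exists_eq_smul_of_zero {ι D : Type*} [CommRing D] [IsDomain D] [Algebra ℂ D] {m : ℕ}
    {A : ι → MvPolynomial (Fin 3) ℂ} (hhom : ∀ k, (A k).IsHomogeneous m)
    (hA : ∀ Q, Irreducible Q → ∃ k, ¬ Q ∣ A k) {y : Fin 3 → D} (hy : ∀ k, aeval y (A k) = 0)
    {i b : Fin 3} (hib : i ≠ b) (hb : y b ≠ 0) : ∃ s : ℂ, y i = s • y b := by
  obtain ⟨σ, hσ1, hσ2⟩ : ∃ σ : Equiv.Perm (Fin 3), σ 1 = i ∧ σ 2 = b := by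
    clear hb; revert i b; decide
  let K := FractionRing (Polynomial D)
  -- The indeterminate passes to the cone over `y`, so that each homogeneous component of an
  -- algebraic relation is itself a relation.
  let y' : Fin 3 → Polynomial D := fun j => Polynomial.X * Polynomial.C (y j)
  have hC : ∀ p : MvPolynomial (Fin 3) ℂ, aeval (fun i => Polynomial.C (y i)) p
      = Polynomial.C (aeval y p) := fun p => by
    have : aeval (fun i => Polynomial.C (y i))
        = (Polynomial.CAlgHom (R := ℂ) (A := D)).comp (aeval y) := by ext1 i; simp
    rw [this]; rfl
  have hy' : ∀ k, aeval (fun j => algebraMap (Polynomial D) K (y' j)) (A k) = 0 := fun k => by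
    refine (aeval_algebraMap_apply K y' (A k)).trans ?_
    rw [(hhom k).aeval_mul_left, hC, hy, map_zero, mul_zero, map_zero]
  have hdep := not_algebraicIndependent_of_zero A hA _ hy' σ
  obtain ⟨R, hR, hR0⟩ : ∃ R : MvPolynomial (Fin 2) ℂ,
      aeval (fun j : Fin 2 => y' (σ j.succ)) R = 0 ∧ R ≠ 0 := by
    rw [algebraicIndependent_iff] at hdep
    push Not at hdep
    obtain ⟨R, hR, hR0⟩ := hdep
    exact ⟨R, (map_eq_zero_iff _ (IsFractionRing.injective (Polynomial D) K)).1
      ((aeval_algebraMap_apply K (fun j : Fin 2 => y' (σ j.succ)) R).symm.trans hR), hR0⟩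
  obtain ⟨j, hj⟩ : ∃ j, homogeneousComponent j R ≠ 0 := by
    by_contra! h
    exact hR0 (by rw [← sum_homogeneousComponent R]; exact Finset.sum_eq_zero fun i _ => h i)
  have hH := aeval_homogeneousComponent_eq_zero (fun j : Fin 2 => y (σ j.succ)) R hR j
  have hHhom := homogeneousComponent_isHomogeneous j R
  generalize homogeneousComponent j R = H at hj hH hHhom
  let L := FractionRing D
  have hb' : algebraMap D L (y b) ≠ 0 := by
    rwa [Ne, map_eq_zero_iff _ (IsFractionRing.injective D L)]
  -- The ratio is a root of the dehomogenized relation `H(X, 1) ≠ 0`, hence algebraic over `ℂ`,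
  -- hence in `ℂ`.
  let t : L := algebraMap D L (y i) / algebraMap D L (y b)
  have ht : IsIntegral ℂ t := by
    refine isAlgebraic_iff_isIntegral.1 ⟨aeval ![Polynomial.X, 1] H, ?_, ?_⟩
    · obtain ⟨x, hx⟩ := exists_eval_ne_zero_of_isHomogeneous_two hHhom hj
      intro h
      have h1 : (Polynomial.aeval x).comp (aeval (R := ℂ) ![(Polynomial.X : Polynomial ℂ), 1])
          = aeval (R := ℂ) ![x, 1] := by ext1 i; fin_cases i <;> simp
      have h2 := DFunLike.congr_fun h1 H
      rw [AlgHom.comp_apply, h, map_zero, aeval_eq_eval] at h2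
      exact hx h2.symm
    · have h1 : (Polynomial.aeval t).comp (aeval (R := ℂ) ![(Polynomial.X : Polynomial ℂ), 1])
          = aeval (R := ℂ) ![t, 1] := by ext1 i; fin_cases i <;> simp
      have h2 := DFunLike.congr_fun h1 H
      rw [AlgHom.comp_apply] at h2
      rw [h2]
      have h3 := congrArg (algebraMap D L) hH
      have h4 : (algebraMap D L ∘ fun j : Fin 2 => y (σ j.succ))
          = fun j => algebraMap D L (y b) * ![t, 1] j := by
        ext j
        fin_cases j
        · simp [t, hσ1, mul_div_cancel₀ _ hb']
        · simp [hσ2]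
      rw [← aeval_algebraMap_apply, h4, hHhom.aeval_mul_left, map_zero] at h3
      exact (mul_eq_zero.1 h3).resolve_left (pow_ne_zero _ hb')
  obtain ⟨s, hs⟩ := minpoly.mem_range_of_degree_eq_one ℂ t
    (IsAlgClosed.degree_eq_one_of_irreducible ℂ (minpoly.irreducible ht))
  refine ⟨s, IsFractionRing.injective D L ?_⟩
  rw [Algebra.smul_def, map_mul, ← IsScalarTower.algebraMap_apply, hs, div_mul_cancel₀ _ hb']

/-- Two polynomials that vanish on `P = 0` have proportional differentials there. -/
theorem mul_eq_mul_of_dvd_of_pderiv {σ ι : Type*} [Fintype ι] {P R₁ R₂ : MvPolynomial σ ℂ}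
    {F : ι → MvPolynomial σ ℂ} [IsDomain (MvPolynomial σ ℂ ⧸ Ideal.span {P})]
    (hind : ∀ c : ι → MvPolynomial σ ℂ ⧸ Ideal.span {P},
      (∀ j, ∑ i, c i * Ideal.Quotient.mk _ (pderiv j (F i)) = 0) → c = 0)
    (h₁ : P ∣ R₁) (h₂ : P ∣ R₂) {r₁ r₂ : ι → MvPolynomial σ ℂ ⧸ Ideal.span {P}}
    (hr₁ : ∀ j, Ideal.Quotient.mk _ (pderiv j R₁)
      = ∑ i, r₁ i * Ideal.Quotient.mk _ (pderiv j (F i)))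
    (hr₂ : ∀ j, Ideal.Quotient.mk _ (pderiv j R₂)
      = ∑ i, r₂ i * Ideal.Quotient.mk _ (pderiv j (F i))) (a c : ι) :
    r₁ a * r₂ c = r₁ c * r₂ a := by
  obtain ⟨g₁, rfl⟩ := h₁
  obtain ⟨g₂, rfl⟩ := h₂
  have hP : Ideal.Quotient.mk (Ideal.span {P}) P = 0 :=
    Ideal.Quotient.eq_zero_iff_mem.2 (Ideal.mem_span_singleton_self P)
  simp only [Derivation.leibniz, smul_eq_mul, map_add, map_mul, hP, zero_mul, zero_add] at hr₁ hr₂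
  -- Modulo `P`, `d(P g) = g dP`; both differentials are multiples of `dP`, and the cross
  -- combination vanishes.
  have h0 := hind (fun i => Ideal.Quotient.mk _ g₂ * r₁ i - Ideal.Quotient.mk _ g₁ * r₂ i)
    fun j => by
      simp only [sub_mul, Finset.sum_sub_distrib, mul_assoc, ← Finset.mul_sum, ← hr₁, ← hr₂]
      ring
  have h1 : ∀ i, Ideal.Quotient.mk _ g₂ * r₁ i = Ideal.Quotient.mk _ g₁ * r₂ i :=
    fun i => sub_eq_zero.1 (congrFun h0 i)
  by_cases hg : Ideal.Quotient.mk (Ideal.span {P}) g₂ = 0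
  · have : r₂ = 0 := hind r₂ fun j => by rw [← hr₂, hg, zero_mul]
    simp [this]
  · refine mul_left_cancel₀ hg ?_
    rw [← mul_assoc, ← mul_assoc, h1, h1]; ring

/-- Polynomials with independent differentials along `P = 0` do not satisfy there, after taking
powers, homogeneous equations without common factor. -/
theorem exists_not_dvd_aeval_pow {σ κ : Type*} {P : MvPolynomial σ ℂ} (hP : Prime P)
    {F : Fin 3 → MvPolynomial σ ℂ}
    (hind : ∀ c : Fin 3 → MvPolynomial σ ℂ ⧸ Ideal.span {P},
      (∀ j, ∑ i, c i * Ideal.Quotient.mk _ (pderiv j (F i)) = 0) → c = 0)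
    {e : Fin 3 → ℕ} (he : ∀ i, e i ≠ 0) {m : ℕ} {A : κ → MvPolynomial (Fin 3) ℂ}
    (hhom : ∀ k, (A k).IsHomogeneous m) (hA : ∀ Q, Irreducible Q → ∃ k, ¬ Q ∣ A k) :
    ∃ k, ¬ P ∣ aeval (fun i => F i ^ e i) (A k) := by
  by_contra! hdvd
  have hprime : (Ideal.span {P}).IsPrime := (Ideal.span_singleton_prime hP.ne_zero).2 hP
  let D := MvPolynomial σ ℂ ⧸ Ideal.span {P}
  let π : MvPolynomial σ ℂ →ₐ[ℂ] D := Ideal.Quotient.mkₐ ℂ (Ideal.span {P})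
  have hπ : ∀ p, π p = 0 ↔ P ∣ p := fun p => by
    rw [← Ideal.mem_span_singleton]; exact Ideal.Quotient.eq_zero_iff_mem
  have hchar : CharZero D := charZero_of_injective_algebraMap (algebraMap ℂ D).injective
  have hy : ∀ k, aeval (fun i => π (F i ^ e i)) (A k) = 0 := fun k => by
    have := comp_aeval_apply (fun i => F i ^ e i) π (A k)
    rw [← this, hπ]; exact hdvd k
  by_cases hall : ∀ i, P ∣ F i
  · have h := mul_eq_mul_of_dvd_of_pderiv hind (hall 0) (hall 1)
      (r₁ := Pi.single 0 1) (r₂ := Pi.single 1 1)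
      (fun j => by simp [Pi.single_apply]) (fun j => by simp [Pi.single_apply]) 0 1
    simp at h
  push Not at hall
  obtain ⟨b, hb⟩ := hall
  -- For each `i ≠ b`, a function vanishing on `P = 0` whose differential involves `dFᵢ` and
  -- otherwise at most `dF_b`: `Fᵢ` itself, or `Fᵢ ^ eᵢ - s F_b ^ e_b`.
  have key : ∀ i, i ≠ b → ∃ (R : MvPolynomial σ ℂ) (r : Fin 3 → D), P ∣ R ∧
      (∀ j, π (pderiv j R) = ∑ k, r k * π (pderiv j (F k))) ∧ r i ≠ 0 ∧
      ∀ k, k ≠ i → k ≠ b → r k = 0 := by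
    intro i hib
    by_cases hi : P ∣ F i
    · exact ⟨F i, Pi.single i 1, hi, fun j => by simp [Pi.single_apply], by simp,
        fun k hk _ => by simp [hk]⟩
    · obtain ⟨s, hs⟩ := exists_eq_smul_of_zero hhom hA hy hib
        (by rw [Ne, hπ]; exact fun h => hb (hP.dvd_of_dvd_pow h))
      have hpow : ∀ k j, π (pderiv j (F k ^ e k))
          = (e k * π (F k) ^ (e k - 1)) * π (pderiv j (F k)) := fun k j => by
        simp [Derivation.leibniz_pow, mul_assoc]
      refine ⟨F i ^ e i - s • F b ^ e b,
        Pi.single i (e i * π (F i) ^ (e i - 1)) - Pi.single b (s • (e b * π (F b) ^ (e b - 1))),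
        ?_, fun j => ?_, ?_, fun k hk hk' => by simp [hk, hk']⟩
      · rw [← hπ, map_sub, map_smul, hs, sub_self]
      · rw [map_sub, map_sub, Derivation.map_smul, map_smul, hpow, hpow]
        simp [Pi.single_apply, sub_mul, Finset.sum_sub_distrib, smul_mul_assoc]
      · have : π (F i) ≠ 0 := by rwa [Ne, hπ]
        simp [hib, he i, this]
  obtain ⟨i, k, hib, hkb, hik⟩ : ∃ i k : Fin 3, i ≠ b ∧ k ≠ b ∧ i ≠ k := by
    clear hb key; revert b; decide
  obtain ⟨R₁, r₁, h₁, hr₁, hi₁, hz₁⟩ := key i hib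
  obtain ⟨R₂, r₂, h₂, hr₂, hi₂, hz₂⟩ := key k hkb
  -- The `(i, k)` minor of the two differentials is `r₁ i * r₂ k`, because `r₁ k = 0`.
  have := mul_eq_mul_of_dvd_of_pderiv hind h₁ h₂ hr₁ hr₂ i k
  rw [hz₁ k hik.symm hkb, zero_mul] at this
  exact mul_ne_zero hi₁ hi₂ this

end MvPolynomial

/-! ### Tangencies along a line -/

/-- The polynomial in `t` given by a 1-form along `t ↦ p + t q`, applied to the velocity `q`. -/
noncomputable def PolyForm.alongLine {n : ℕ} (ω : PolyForm n) (p q : Fin (n + 1) → ℂ) :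
    Polynomial ℂ :=
  ∑ j, MvPolynomial.aeval
      (fun i => Polynomial.C (p i) + Polynomial.C (q i) * Polynomial.X) (ω j)
    * Polynomial.C (q j)

namespace PolyForm

open MvPolynomial (eval)

variable {n : ℕ} (ω : PolyForm n) (p q : Fin (n + 1) → ℂ)

theorem eval_alongLine (t : ℂ) :
    (ω.alongLine p q).eval t = ∑ j, eval (p + t • q) (ω j) * q j := by
  have h : ∀ P : MvPolynomial (Fin (n + 1)) ℂ, (MvPolynomial.aeval
      (fun i => Polynomial.C (p i) + Polynomial.C (q i) * Polynomial.X) P).eval t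
        = eval (p + t • q) P := fun P => by
    have h1 : (Polynomial.aeval t).comp (MvPolynomial.aeval (R := ℂ)
        (fun i => Polynomial.C (p i) + Polynomial.C (q i) * Polynomial.X))
          = MvPolynomial.aeval (p + t • q) := by
      ext1 i; simp [mul_comm t]
    have h2 := DFunLike.congr_fun h1 P
    rwa [MvPolynomial.aeval_eq_eval, AlgHom.comp_apply, Polynomial.coe_aeval_eq_eval] at h2
  simp only [alongLine, Polynomial.eval_finsetSum, Polynomial.eval_mul, Polynomial.eval_C, h]

theorem alongLine_add_smul (t : ℂ) :
    ω.alongLine (p + t • q) q = (ω.alongLine p q).comp (Polynomial.X + Polynomial.C t) := by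
  refine Polynomial.funext fun s => ?_
  simp only [eval_alongLine, Polynomial.eval_comp, Polynomial.eval_add, Polynomial.eval_X,
    Polynomial.eval_C, add_smul]
  refine Finset.sum_congr rfl fun j _ => ?_
  rw [add_assoc, add_comm (t • q)]

theorem tangencyOrder_eq_rootMultiplicity (h : ω.alongLine p q ≠ 0) :
    ω.tangencyOrder p q = (ω.alongLine p q).rootMultiplicity 0 := by
  have : ω.tangencyOrder p q = emultiplicity Polynomial.X (ω.alongLine p q) := rfl
  rw [this, Polynomial.rootMultiplicity_eq_multiplicity, if_neg h, Polynomial.C_0, sub_zero]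
  refine FiniteMultiplicity.emultiplicity_eq_multiplicity ?_
  have := Polynomial.finiteMultiplicity_X_sub_C 0 h
  rwa [Polynomial.C_0, sub_zero] at this

theorem tangencyOrder_add_smul (h : ω.alongLine p q ≠ 0) (t : ℂ) :
    ω.tangencyOrder (p + t • q) q = (ω.alongLine p q).rootMultiplicity t := by
  have h0 : ω.alongLine (p + t • q) q ≠ 0 := by
    rw [alongLine_add_smul, Ne, Polynomial.comp_X_add_C_eq_zero_iff]; exact h
  rw [tangencyOrder_eq_rootMultiplicity _ _ _ h0, alongLine_add_smul,
    ← Polynomial.rootMultiplicity_eq_rootMultiplicity]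

theorem finite_tangencyOrder_ne_zero (h : ω.alongLine p q ≠ 0) :
    {t : ℂ | ω.tangencyOrder (p + t • q) q ≠ 0}.Finite := by
  refine (ω.alongLine p q).roots.toFinset.finite_toSet.subset fun t ht => ?_
  rw [Set.mem_ofPred_eq, tangencyOrder_add_smul _ _ _ h] at ht
  rw [Finset.mem_coe, Multiset.mem_toFinset, ← Multiset.count_pos, Polynomial.count_roots]
  exact Nat.pos_of_ne_zero fun h0 => ht (by rw [h0]; rfl)

theorem finsum_tangencyOrder (h : ω.alongLine p q ≠ 0) :
    ∑ᶠ t : ℂ, ω.tangencyOrder (p + t • q) q = (ω.alongLine p q).natDegree := by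
  rw [finsum_congr (tangencyOrder_add_smul ω p q h),
    finsum_eq_sum_of_support_subset (s := (ω.alongLine p q).roots.toFinset) _ fun t ht => ?_,
    ← Nat.cast_sum, (IsAlgClosed.splits (ω.alongLine p q)).natDegree_eq_card_roots,
    ← Multiset.toFinset_sum_count_eq]
  · simp only [Polynomial.count_roots]
  · rw [Finset.mem_coe, Multiset.mem_toFinset, ← Multiset.count_pos, Polynomial.count_roots]
    exact Nat.pos_of_ne_zero fun h0 => ht (by simp [h0])

variable {ω p q}

/-- Since `p + t q = t (q + t⁻¹ p)`, homogeneity gives `t ^ (k + 1)`; the Euler relation trades the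
velocity `q` for `-t⁻¹ p`, which costs one power of `t`. -/
theorem eval_alongLine_swap {k : ℕ} (hhom : ∀ j, (ω j).IsHomogeneous (k + 1))
    (heuler : ∑ j, MvPolynomial.X j * ω j = 0) {t : ℂ} (ht : t ≠ 0) :
    (ω.alongLine p q).eval t = -(t ^ k * (ω.alongLine q p).eval t⁻¹) := by
  rw [eval_alongLine, eval_alongLine]
  have h1 : p + t • q = t • (q + t⁻¹ • p) := by
    rw [smul_add, smul_smul, mul_inv_cancel₀ ht, one_smul]
    exact add_comm _ _
  have h2 := congrArg (eval (q + t⁻¹ • p)) heuler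
  simp only [map_sum, map_mul, MvPolynomial.eval_X, Pi.add_apply, Pi.smul_apply, smul_eq_mul,
    map_zero, add_mul, Finset.sum_add_distrib, mul_assoc, ← Finset.mul_sum] at h2
  have h3 : ∑ j, eval (q + t⁻¹ • p) (ω j) * q j
      = -(t⁻¹ * ∑ j, eval (q + t⁻¹ • p) (ω j) * p j) := by
    rw [← eq_neg_iff_add_eq_zero] at h2
    simpa only [mul_comm] using h2
  simp only [h1, (hhom _).eval_smul, mul_assoc, ← Finset.mul_sum, h3]
  rw [pow_succ]
  linear_combination -(t ^ k * ∑ x, eval (q + t⁻¹ • p) (ω x) * p x) * mul_inv_cancel₀ ht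

/-- The swap `T(t) = -t ^ k U(1/t)` says that `T` is, up to sign and powers of `t`, the reverse of
`U`; the order of `U` at `0` is what `T` lacks from degree `k`. -/
theorem natDegree_alongLine_add_rootMultiplicity {k : ℕ}
    (hhom : ∀ j, (ω j).IsHomogeneous (k + 1)) (heuler : ∑ j, MvPolynomial.X j * ω j = 0)
    (h : ω.alongLine p q ≠ 0) :
    ω.alongLine q p ≠ 0 ∧
      (ω.alongLine q p).rootMultiplicity 0 + (ω.alongLine p q).natDegree = k := by
  have hne : ω.alongLine q p ≠ 0 := by
    intro h0
    refine h (Polynomial.eq_zero_of_infinite_isRoot _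
      ((Set.finite_singleton (0 : ℂ)).infinite_compl.mono fun t ht => ?_))
    rw [Set.mem_ofPred_eq, Polynomial.IsRoot, eval_alongLine_swap hhom heuler ht, h0]
    simp
  refine ⟨hne, ?_⟩
  set T := ω.alongLine p q
  set U := ω.alongLine q p
  have hrev : U.reverse ≠ 0 := by rwa [Ne, Polynomial.reverse_eq_zero]
  have key : Polynomial.X ^ U.natDegree * T = -(Polynomial.X ^ k * U.reverse) := by
    rw [← sub_eq_zero]
    refine Polynomial.eq_zero_of_infinite_isRoot _
      ((Set.finite_singleton (0 : ℂ)).infinite_compl.mono fun t ht => ?_)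
    have ht : t ≠ 0 := ht
    let _ := invertibleOfNonzero (inv_ne_zero ht)
    have h1 := Polynomial.eval₂_reverse_mul_pow (RingHom.id ℂ) t⁻¹ U
    rw [invOf_eq_inv, inv_inv, ← Polynomial.eval, ← Polynomial.eval] at h1
    rw [Set.mem_ofPred_eq, Polynomial.IsRoot, Polynomial.eval_sub, Polynomial.eval_neg,
      Polynomial.eval_mul, Polynomial.eval_mul, eval_alongLine_swap hhom heuler ht, ← h1,
      Polynomial.eval_pow, Polynomial.eval_pow, Polynomial.eval_X, inv_pow]
    linear_combination (-t ^ k * U.reverse.eval t) * mul_inv_cancel₀ (pow_ne_zero U.natDegree ht)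
  have hdeg := congrArg Polynomial.natDegree key
  rw [Polynomial.natDegree_neg, Polynomial.natDegree_mul (pow_ne_zero _ Polynomial.X_ne_zero) h,
    Polynomial.natDegree_mul (pow_ne_zero _ Polynomial.X_ne_zero) hrev, Polynomial.natDegree_X_pow,
    Polynomial.natDegree_X_pow, Polynomial.reverse_natDegree] at hdeg
  have := Polynomial.natTrailingDegree_le_natDegree U
  rw [Polynomial.rootMultiplicity_eq_natTrailingDegree']
  omega

theorem tangencyCount_of_alongLine_ne_zero {k : ℕ} (hhom : ∀ j, (ω j).IsHomogeneous (k + 1))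
    (heuler : ∑ j, MvPolynomial.X j * ω j = 0) (h : ω.alongLine p q ≠ 0) :
    ω.TangencyCount p q k := by
  obtain ⟨h1, h2⟩ := natDegree_alongLine_add_rootMultiplicity hhom heuler h
  refine ⟨ω.finite_tangencyOrder_ne_zero p q h, ?_⟩
  rw [finsum_tangencyOrder _ _ _ h, tangencyOrder_eq_rootMultiplicity _ _ _ h1]
  exact_mod_cast h2

end PolyForm

/-! ### Degree of a foliation and degree of its coefficients -/

namespace Foliation

open MvPolynomial (eval)

variable {n : ℕ} (𝓕 : Foliation n)

theorem exists_form_ne_zero : ∃ j, 𝓕.form j ≠ 0 := by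
  by_contra! h
  exact 𝓕.codim_two 0 (by simp) fun z _ j => by simp [h]

theorem exists_not_dvd_form (P : MvPolynomial (Fin (n + 1)) ℂ) (hP : Irreducible P) :
    ∃ j, ¬ P ∣ 𝓕.form j := by
  by_contra! h
  refine 𝓕.codim_two P hP.not_isUnit fun z hz j => ?_
  obtain ⟨g, hg⟩ := h j
  rw [hg, map_mul, hz, zero_mul]

theorem hasDegree_of_isHomogeneous {k : ℕ} (hhom : ∀ j, (𝓕.form j).IsHomogeneous (k + 1)) :
    𝓕.HasDegree k := by
  -- `Q(a, b) = Ω(a) · b`, the value at `t = 0` along the line; where it is nonzero the line is not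
  -- invariant.
  let Q : MvPolynomial (Fin (n + 1) ⊕ Fin (n + 1)) ℂ :=
    ∑ j, MvPolynomial.rename Sum.inl (𝓕.form j) * MvPolynomial.X (Sum.inr j)
  have hQ : ∀ a b, eval (Sum.elim a b) Q = (𝓕.form.alongLine a b).eval 0 := fun a b => by
    simp [Q, PolyForm.eval_alongLine, MvPolynomial.eval_rename]
  refine ⟨Q, fun h0 => ?_, fun a b _ hab =>
    PolyForm.tangencyCount_of_alongLine_ne_zero hhom 𝓕.euler fun h0 => hab ?_⟩
  · obtain ⟨j, hj⟩ := 𝓕.exists_form_ne_zero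
    refine hj (MvPolynomial.funext fun a => ?_)
    have := hQ a (Pi.single j 1)
    rw [h0, PolyForm.eval_alongLine] at this
    simpa [Pi.single_apply] using this.symm
  · rw [hQ, h0, Polynomial.eval_zero]

theorem pos_of_isHomogeneous {m : ℕ} (hhom : ∀ j, (𝓕.form j).IsHomogeneous m) : 0 < m := by
  refine Nat.pos_of_ne_zero fun h0 => ?_
  subst h0
  obtain ⟨j, hj⟩ := 𝓕.exists_form_ne_zero
  refine hj ?_
  have hC : ∀ i, ∃ c, 𝓕.form i = MvPolynomial.C c := fun i =>
    ⟨_, MvPolynomial.totalDegree_eq_zero_iff_eq_C.1 (Nat.le_zero.1 (hhom i).totalDegree_le)⟩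
  choose c hc using hC
  have h1 := congrArg (eval (Pi.single j 1)) 𝓕.euler
  simp only [hc] at h1 ⊢
  simpa [Pi.single_apply] using h1

variable {𝓕}

theorem HasDegree.unique {k l : ℕ} {i j : Fin (n + 1)} (hij : i ≠ j) (hk : 𝓕.HasDegree k)
    (hl : 𝓕.HasDegree l) : k = l := by
  obtain ⟨Q₁, hQ₁, h₁⟩ := hk
  obtain ⟨Q₂, hQ₂, h₂⟩ := hl
  -- A nonzero minor guarantees that `a`, `b` span a line, so both counts apply to one line.
  let Δ : MvPolynomial (Fin (n + 1) ⊕ Fin (n + 1)) ℂ :=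
    MvPolynomial.X (Sum.inl i) * MvPolynomial.X (Sum.inr j)
      - MvPolynomial.X (Sum.inl j) * MvPolynomial.X (Sum.inr i)
  have hΔ : Δ ≠ 0 := fun h0 => by
    have := congrArg (eval (Sum.elim (Pi.single i 1) (Pi.single j 1))) h0
    simp [Δ, hij, hij.symm] at this
  obtain ⟨z, hz⟩ : ∃ z, eval z (Δ * Q₁ * Q₂) ≠ 0 := by
    by_contra! h
    exact mul_ne_zero (mul_ne_zero hΔ hQ₁) hQ₂ (MvPolynomial.funext fun z => by rw [h, map_zero])
  rw [← Sum.elim_comp_inl_inr z] at hz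
  generalize z ∘ Sum.inl = a at hz
  generalize z ∘ Sum.inr = b at hz
  simp only [map_mul, mul_ne_zero_iff] at hz
  obtain ⟨⟨hz, hz₁⟩, hz₂⟩ := hz
  have hind : LinearIndependent ℂ ![a, b] := by
    rw [LinearIndependent.pair_iff]
    intro s t hst
    have hi := congrFun hst i
    have hj := congrFun hst j
    simp only [Pi.add_apply, Pi.smul_apply, smul_eq_mul, Pi.zero_apply] at hi hj
    simp [Δ] at hz
    constructor
    · refine (mul_eq_zero.1 (?_ : s * (a i * b j - a j * b i) = 0)).resolve_right hz
      linear_combination b j * hi - b i * hj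
    · refine (mul_eq_zero.1 (?_ : t * (a i * b j - a j * b i) = 0)).resolve_right hz
      linear_combination a i * hj - a j * hi
  exact_mod_cast (h₁ a b hind hz₁).2.symm.trans (h₂ a b hind hz₂).2

theorem HasDegree.isHomogeneous {d : ℕ} {i j : Fin (n + 1)} (hij : i ≠ j) (hd : 𝓕.HasDegree d) :
    ∀ j, (𝓕.form j).IsHomogeneous (d + 1) := by
  obtain ⟨m, hm⟩ := 𝓕.homogeneous
  obtain ⟨k, rfl⟩ := Nat.exists_eq_succ_of_ne_zero (𝓕.pos_of_isHomogeneous hm).ne'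
  rwa [hd.unique hij (𝓕.hasDegree_of_isHomogeneous hm)]

end Foliation

/-! ### Independence modulo a hypersurface, and primitive vectors -/

open MvPolynomial (eval pderiv)

/-- If `P` vanishes at a point where the differentials of the `Fᵢ` are independent, these
differentials are independent modulo `P`. -/
theorem IndepDifferentials.eq_zero_of_sum_mul_pderiv {n : ℕ}
    {F : Fin 3 → MvPolynomial (Fin (n + 1)) ℂ} {w : Fin (n + 1) → ℂ} (h : IndepDifferentials F w)
    {P : MvPolynomial (Fin (n + 1)) ℂ} (hP : Prime P) (hw : eval w P = 0)
    (c : Fin 3 → MvPolynomial (Fin (n + 1)) ℂ ⧸ Ideal.span {P})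
    (hc : ∀ j, ∑ i, c i * Ideal.Quotient.mk _ (pderiv j (F i)) = 0) : c = 0 := by
  have hprime : (Ideal.span {P}).IsPrime := (Ideal.span_singleton_prime hP.ne_zero).2 hP
  let J : Matrix (Fin 3) (Fin (n + 1)) (MvPolynomial (Fin (n + 1)) ℂ) :=
    Matrix.of fun i j => pderiv j (F i)
  -- A constant right inverse of the Jacobian at `w`: the determinant of `J * N'` is `1` at `w`,
  -- where `P` vanishes, so it is nonzero modulo `P`.
  obtain ⟨N, hN⟩ : ∃ N : Matrix (Fin (n + 1)) (Fin 3) ℂ, J.map (eval w) * N = 1 := by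
    have h1 : LinearIndependent ℂ (J.map (eval w)).row := h
    rw [← Matrix.vecMul_injective_iff] at h1
    obtain ⟨g, hg⟩ := LinearMap.exists_leftInverse_of_injective (J.map (eval w)).vecMulLinear
      (LinearMap.ker_eq_bot.2 h1)
    refine ⟨Matrix.of fun j i => g (fun l => if j = l then 1 else 0) i, ?_⟩
    ext i l
    have h2 := congrFun (LinearMap.congr_fun hg (Pi.single i 1)) l
    rw [LinearMap.comp_apply, Matrix.vecMulLinear_apply, Matrix.single_one_vecMul,
      LinearMap.pi_apply_eq_sum_univ g] at h2
    simpa [Matrix.mul_apply, Matrix.one_apply, Pi.single_apply, eq_comm] using h2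
  let N' : Matrix (Fin (n + 1)) (Fin 3) (MvPolynomial (Fin (n + 1)) ℂ) := N.map MvPolynomial.C
  let K : Matrix (Fin 3) (Fin 3) (MvPolynomial (Fin (n + 1)) ℂ) := J * N'
  have hdet : Ideal.Quotient.mk (Ideal.span {P}) K.det ≠ 0 := by
    rw [Ne, Ideal.Quotient.eq_zero_iff_dvd]
    rintro ⟨g, hg⟩
    have h1 := congrArg (eval w) hg
    have h2 : K.map (eval w) = 1 := by
      rw [← hN]
      rw [show K = J * N' from rfl, Matrix.map_mul]
      congr 1
      ext i j; simp [N']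
    rw [RingHom.map_det, RingHom.mapMatrix_apply, h2, Matrix.det_one, map_mul, hw, zero_mul] at h1
    exact one_ne_zero h1
  rw [RingHom.map_det] at hdet
  refine Matrix.eq_zero_of_vecMul_eq_zero hdet ?_
  have h3 : Matrix.vecMul c (J.map (Ideal.Quotient.mk (Ideal.span {P}))) = 0 := by
    ext j
    exact hc j
  rw [RingHom.mapMatrix_apply, show K = J * N' from rfl, Matrix.map_mul,
    ← Matrix.vecMul_vecMul, h3, Matrix.zero_vecMul]

/-- A prime factor of `M` misses some `φ j`, so it divides `h` and can be cancelled; induct on the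
factors. -/
theorem dvd_of_dvd_mul_of_forall_irreducible {R ι : Type*} [CommRing R] [IsDomain R]
    [UniqueFactorizationMonoid R] {φ : ι → R} (hφ : ∀ p, Irreducible p → ∃ j, ¬ p ∣ φ j)
    {M : R} (hM : M ≠ 0) {h : R} (hdvd : ∀ j, M ∣ h * φ j) : M ∣ h := by
  induction M using UniqueFactorizationMonoid.induction_on_prime generalizing h with
  | h₁ => exact absurd rfl hM
  | h₂ x hx => exact hx.dvd
  | h₃ a p ha hp ih =>
    obtain ⟨j, hj⟩ := hφ p hp.irreducible
    obtain ⟨g, rfl⟩ := (hp.dvd_or_dvd ((dvd_mul_right p a).trans (hdvd j))).resolve_right hj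
    refine mul_dvd_mul_left p (ih ha fun i => ?_)
    have := hdvd i
    rwa [mul_assoc, mul_dvd_mul_iff_left hp.ne_zero] at this

/-! ### Forms with invariant coordinate lines -/

namespace Foliation

variable {G : Foliation 2}

theorem X_dvd_form (hG : ∀ i : Fin 3, G.IsInvariant (MvPolynomial.X i)) {i a : Fin 3}
    (hia : i ≠ a) : MvPolynomial.X i ∣ G.form a := by
  have := (hG i).2.2 a i
  rwa [MvPolynomial.pderiv_X_self, MvPolynomial.pderiv_X_of_ne hia, mul_one, mul_zero,
    sub_zero] at this

/-- A form with invariant coordinate lines is `x₀x₁x₂ ∑ Bᵢ dxᵢ/xᵢ`. -/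
theorem exists_form_eq_prod_mul (hG : ∀ i : Fin 3, G.IsInvariant (MvPolynomial.X i)) :
    ∃ B : Fin 3 → MvPolynomial (Fin 3) ℂ,
      ∀ a, G.form a = (∏ k ∈ Finset.univ.erase a, MvPolynomial.X k) * B a := by
  have : ∀ a, (∏ k ∈ Finset.univ.erase a, MvPolynomial.X k) ∣ G.form a := fun a => by
    refine Finset.prod_dvd_of_isRelPrime (fun i _ j _ hij => ?_) fun i hi =>
      X_dvd_form hG (Finset.ne_of_mem_erase hi)
    refine (MvPolynomial.X_prime.irreducible.isRelPrime_iff_not_dvd).2 ?_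
    rw [MvPolynomial.X_dvd_X]
    simp [hij]
  choose B hB using this
  exact ⟨B, hB⟩

/-- The coordinate point where `x₀ = x₁ = 0` is singular. -/
theorem eval_form_eq_zero (hG : ∀ i : Fin 3, G.IsInvariant (MvPolynomial.X i)) {v : Fin 3 → ℂ}
    (h0 : v 0 = 0) (h1 : v 1 = 0) (a : Fin 3) : eval v (G.form a) = 0 := by
  obtain ⟨i, hia, hi⟩ : ∃ i, i ≠ a ∧ v i = 0 := by
    by_cases ha : a = 0
    · exact ⟨1, by simp [ha], h1⟩
    · exact ⟨0, Ne.symm ha, h0⟩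
  obtain ⟨g, hg⟩ := X_dvd_form hG hia
  rw [hg, map_mul, MvPolynomial.eval_X, hi, zero_mul]

end Foliation

/-! ### The pull-back divided by its evident factor -/

section pullback

variable {n : ℕ} (e : Fin 3 → ℕ) (F : Fin 3 → MvPolynomial (Fin (n + 1)) ℂ)
  (B : Fin 3 → MvPolynomial (Fin 3) ℂ)

/-- The coefficient of `dFₐ` in the pull-back of `x₀x₁x₂ ∑ Bᵢ dxᵢ/xᵢ` by the `Fᵢ ^ eᵢ`, divided
by `∏ Fᵢ ^ (eᵢ - 1)`. -/
noncomputable def reducedCoeff (a : Fin 3) : MvPolynomial (Fin (n + 1)) ℂ :=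
  e a * ((∏ k ∈ Finset.univ.erase a, F k) * MvPolynomial.aeval (fun i => F i ^ e i) (B a))

/-- The pull-back of `x₀x₁x₂ ∑ Bᵢ dxᵢ/xᵢ` by the `Fᵢ ^ eᵢ`, divided by `∏ Fᵢ ^ (eᵢ - 1)`. -/
noncomputable def reducedPullback : PolyForm n :=
  fun j => ∑ a, reducedCoeff e F B a * pderiv j (F a)

variable {e F B}

theorem pullback_eq_prod_mul_reducedPullback (he : ∀ i, e i ≠ 0) {ω : PolyForm 2}
    (hω : ∀ a, ω a = (∏ k ∈ Finset.univ.erase a, MvPolynomial.X k) * B a) (j : Fin (n + 1)) :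
    ω.pullback (fun i => F i ^ e i) j
      = (∏ i, F i ^ (e i - 1)) * reducedPullback e F B j := by
  rw [PolyForm.pullback, reducedPullback, Finset.mul_sum]
  refine Finset.sum_congr rfl fun a _ => ?_
  have h1 : MvPolynomial.bind₁ (fun i => F i ^ e i) (ω a)
      = (∏ k ∈ Finset.univ.erase a, F k ^ e k) * MvPolynomial.aeval (fun i => F i ^ e i) (B a) := by
    rw [hω, map_mul, map_prod]
    simp only [MvPolynomial.bind₁_X_right]
    rfl
  have h2 : (∏ k ∈ Finset.univ.erase a, F k ^ e k)
      = (∏ k ∈ Finset.univ.erase a, F k ^ (e k - 1)) * ∏ k ∈ Finset.univ.erase a, F k := by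
    rw [← Finset.prod_mul_distrib]
    exact Finset.prod_congr rfl fun k _ => (pow_sub_one_mul (he k) _).symm
  rw [h1, h2, ← Finset.mul_prod_erase Finset.univ _ (Finset.mem_univ a), reducedCoeff,
    Derivation.leibniz_pow, nsmul_eq_mul, smul_eq_mul]
  ring

/-- Up to the unit `e a`, the reduced coefficient has `F k` where the composed coefficient of `ω`
has the higher power `F k ^ e k`. -/
theorem dvd_aeval_of_dvd_reducedCoeff {P : MvPolynomial (Fin (n + 1)) ℂ}
    (he : ∀ i, e i ≠ 0) {ω : PolyForm 2}
    (hω : ∀ a, ω a = (∏ k ∈ Finset.univ.erase a, MvPolynomial.X k) * B a) {a : Fin 3}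
    (ha : P ∣ reducedCoeff e F B a) : P ∣ MvPolynomial.aeval (fun i => F i ^ e i) (ω a) := by
  have hu : IsUnit (e a : MvPolynomial (Fin (n + 1)) ℂ) := by
    rw [← map_natCast (MvPolynomial.C (R := ℂ))]
    exact (isUnit_iff_ne_zero.2 (Nat.cast_ne_zero.2 (he a))).map MvPolynomial.C
  rw [reducedCoeff, hu.dvd_mul_left] at ha
  refine ha.trans ?_
  rw [hω, map_mul, map_prod]
  refine mul_dvd_mul_right (Finset.prod_dvd_prod_of_dvd _ _ fun k _ => ?_) _
  rw [MvPolynomial.aeval_X]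
  exact dvd_pow_self _ (he k)

/-- The pull-back of a foliation with invariant coordinate lines, divided by `∏ Fᵢ ^ (eᵢ - 1)`,
does not vanish on a hypersurface with a point where the `dFᵢ` are independent. -/
theorem exists_not_dvd_reducedPullback {P : MvPolynomial (Fin (n + 1)) ℂ} (hP : Irreducible P)
    {w : Fin (n + 1) → ℂ} (hw : IndepDifferentials F w) (hPw : eval w P = 0)
    (he : ∀ i, e i ≠ 0) {G : Foliation 2} {m : ℕ} (hhom : ∀ j, (G.form j).IsHomogeneous m)
    (hω : ∀ a, G.form a = (∏ k ∈ Finset.univ.erase a, MvPolynomial.X k) * B a) :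
    ∃ j, ¬ P ∣ reducedPullback e F B j := by
  by_contra! hdvd
  have hind := hw.eq_zero_of_sum_mul_pderiv hP.prime hPw
  obtain ⟨k, hk⟩ := MvPolynomial.exists_not_dvd_aeval_pow hP.prime hind he hhom
    G.exists_not_dvd_form
  refine hk (dvd_aeval_of_dvd_reducedCoeff he hω ?_)
  have h0 := hind (fun a => Ideal.Quotient.mk _ (reducedCoeff e F B a)) fun j => by
    simpa [reducedPullback] using (Ideal.Quotient.eq_zero_iff_dvd _ _).2 (hdvd j)
  exact (Ideal.Quotient.eq_zero_iff_dvd _ _).1 (congrFun h0 k)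

end pullback

/-! ### Branched maps, generic pairs and the degree formula -/

variable {n ν α β γ d : ℕ} {F : Fin 3 → MvPolynomial (Fin (n + 1)) ℂ} {G : Foliation 2}

theorem branchedLift_eq :
    branchedLift α β γ F = fun i => F i ^ (![α, β, γ] : Fin 3 → ℕ) i := by
  ext1 i; fin_cases i <;> rfl

namespace IsBRM

theorem exponent_ne_zero (h : IsBRM n ν α β γ F) (i : Fin 3) :
    (![α, β, γ] : Fin 3 → ℕ) i ≠ 0 := by
  have := h.one_lt; have := h.lt₁; have := h.lt₂
  fin_cases i <;> simp <;> omega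

theorem totalDegree_mul (h : IsBRM n ν α β γ F) (i : Fin 3) :
    (F i).totalDegree * (![α, β, γ] : Fin 3 → ℕ) i = ν := by
  fin_cases i
  exacts [h.degree₀, h.degree₁, h.degree₂]

theorem totalDegree_pos (h : IsBRM n ν α β γ F) (i : Fin 3) : 0 < (F i).totalDegree := by
  refine Nat.pos_of_ne_zero fun h0 => ?_
  have := h.totalDegree_mul i
  rw [h0, zero_mul] at this
  have := h.two_le
  omega

theorem eval_zero (h : IsBRM n ν α β γ F) (i : Fin 3) : eval 0 (F i) = 0 := by
  have := (h.homogeneous i).eval_smul 0 0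
  rwa [zero_smul, zero_pow (h.totalDegree_pos i).ne', zero_mul] at this

theorem ne_zero (h : IsBRM n ν α β γ F) (i : Fin 3) : F i ≠ 0 := fun h0 => by
  have := h.totalDegree_pos i
  simp [h0] at this

theorem isHomogeneous_pow (h : IsBRM n ν α β γ F) (i : Fin 3) :
    (F i ^ (![α, β, γ] : Fin 3 → ℕ) i).IsHomogeneous ν := by
  rw [← h.totalDegree_mul i]
  exact (h.homogeneous i).pow _

theorem isHomogeneous_pullback (h : IsBRM n ν α β γ F) {ω : PolyForm 2} {m : ℕ}
    (hω : ∀ j, (ω j).IsHomogeneous m) (j : Fin (n + 1)) :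
    (ω.pullback (branchedLift α β γ F) j).IsHomogeneous (ν * m + (ν - 1)) := by
  rw [branchedLift_eq]
  exact MvPolynomial.IsHomogeneous.sum _ _ _ fun i _ =>
    ((hω i).aeval _ h.isHomogeneous_pow).mul (h.isHomogeneous_pow i).pderiv

end IsBRM

namespace IsGenericPair

/-- A hypersurface through the origin contains a point, not the origin, where the differentials of
the `Fᵢ` are independent. -/
theorem exists_indepDifferentials (h : IsGenericPair n ν α β γ d F G) (hn : 3 ≤ n)
    {P : MvPolynomial (Fin (n + 1)) ℂ} (hP : eval 0 P = 0) :
    ∃ w, IndepDifferentials F w ∧ eval w P = 0 := by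
  have hb := h.generic.brm
  -- Three equations in `n + 1 ≥ 4` variables.
  obtain ⟨w, hw0, hw⟩ := MvPolynomial.exists_ne_zero_forall_eval_eq_zero {P, F 0, F 1}
    (Set.toFinite _) (by
      have := Set.ncard_insert_le P {F 0, F 1}
      have := Set.ncard_insert_le (F 0) {F 1}
      rw [Set.ncard_singleton] at this
      omega)
    (by simp [hP, hb.eval_zero, -MvPolynomial.eval_zero])
  refine ⟨w, ?_, hw P (by simp)⟩
  have hv : ∀ i, branchedValue α β γ F w i = eval w (F i) ^ (![α, β, γ] : Fin 3 → ℕ) i := fun i => by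
    rw [branchedValue, branchedLift_eq, map_pow]
  by_cases hbase : branchedValue α β γ F w = 0
  · exact h.generic.transverse w hw0 hbase
  by_contra hcrit
  -- Here `w` maps to `(0:0:1)`, a singularity because it lies on two invariant lines; singularities
  -- avoid the critical image.
  have hmem : Projectivization.mk ℂ _ hbase ∈ G.sing ∩ criticalImage α β γ F := by
    refine ⟨fun a => ?_, w, hbase, hcrit, rfl⟩
    obtain ⟨c, hc⟩ := Projectivization.exists_smul_eq_mk_rep ℂ _ hbase
    rw [← hc]
    refine Foliation.eval_form_eq_zero h.coord_lines ?_ ?_ a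
    · rw [Pi.smul_apply, hv, hw (F 0) (by simp), zero_pow (hb.exponent_ne_zero 0), smul_zero]
    · rw [Pi.smul_apply, hv, hw (F 1) (by simp), zero_pow (hb.exponent_ne_zero 1), smul_zero]
  rw [h.sing_disjoint] at hmem
  exact hmem

/-- The pull-back foliation is given by the pull-back form divided by `∏ Fᵢ ^ (eᵢ - 1)`. -/
theorem exists_pullback_eq (h : IsGenericPair n ν α β γ d F G) (hn : 3 ≤ n) {𝓕 : Foliation n}
    (h𝓕 : 𝓕.IsPullback α β γ F G) :
    ∃ c : ℂ, c ≠ 0 ∧ ∀ j, G.form.pullback (branchedLift α β γ F) j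
      = (∏ i, F i ^ ((![α, β, γ] : Fin 3 → ℕ) i - 1)) * MvPolynomial.C c * 𝓕.form j := by
  have hb := h.generic.brm
  have hhom := h.memM.degree.isHomogeneous (i := 0) (j := 1) (by decide)
  obtain ⟨g, hg0, hg⟩ := h𝓕
  obtain ⟨B, hB⟩ := Foliation.exists_form_eq_prod_mul h.coord_lines
  have hpull := pullback_eq_prod_mul_reducedPullback (F := F) hb.exponent_ne_zero hB
  rw [← branchedLift_eq] at hpull
  set M := ∏ i, F i ^ ((![α, β, γ] : Fin 3 → ℕ) i - 1)
  have hM : M ≠ 0 := Finset.prod_ne_zero_iff.2 fun i _ => pow_ne_zero _ (hb.ne_zero i)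
  have hprim : ∀ P, Irreducible P → ∃ j, ¬ P ∣ reducedPullback ![α, β, γ] F B j := fun P hP => by
    obtain ⟨j, hj⟩ := 𝓕.exists_form_ne_zero
    by_cases hdvd : P ∣ reducedPullback ![α, β, γ] F B j
    swap
    · exact ⟨j, hdvd⟩
    -- A nonconstant divisor of a nonzero homogeneous polynomial passes through the origin.
    have hP0 : eval 0 P = 0 := by
      by_contra hne
      have hC := MvPolynomial.eq_C_of_dvd_isHomogeneous (hb.isHomogeneous_pullback hhom j)
        (by rw [hg]; exact mul_ne_zero hg0 hj) (by rw [hpull]; exact hdvd.mul_left M) hne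
      refine hP.not_isUnit ?_
      rw [hC]
      exact (isUnit_iff_ne_zero.2 hne).map MvPolynomial.C
    obtain ⟨w, hw, hPw⟩ := h.exists_indepDifferentials hn hP0
    exact exists_not_dvd_reducedPullback hP hw hPw hb.exponent_ne_zero hhom hB
  -- Both `𝓕.form` and the reduced pull-back are primitive, so the cofactors `g` and `M` divide each
  -- other.
  have h1 : M ∣ g := dvd_of_dvd_mul_of_forall_irreducible 𝓕.exists_not_dvd_form hM fun j => by
    rw [← hg, hpull]; exact dvd_mul_right _ _
  have h2 : g ∣ M := dvd_of_dvd_mul_of_forall_irreducible hprim hg0 fun j => by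
    rw [← hpull, hg]; exact dvd_mul_right _ _
  obtain ⟨u, hu⟩ := associated_of_dvd_dvd h1 h2
  obtain ⟨c, hc, hcu⟩ := MvPolynomial.isUnit_iff_eq_C_of_isReduced.1 u.isUnit
  exact ⟨c, hc.ne_zero, fun j => by rw [hg, ← hu, hcu]⟩

end IsGenericPair

theorem mainTheorem4 (n ν α β γ d : ℕ) (hn : 3 ≤ n) (hd : 2 ≤ d)
    (F : Fin 3 → MvPolynomial (Fin (n + 1)) ℂ) (G : Foliation 2)
    (hpair : IsGenericPair n ν α β γ d F G)
    (𝓕 : Foliation n) (h𝓕 : 𝓕.IsPullback α β γ F G) :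
    ∃ k : ℕ, 𝓕.HasDegree k ∧
      (k : ℚ) = (ν : ℚ) * (((d : ℚ) - 1) + 1 / (α : ℚ) + 1 / (β : ℚ) + 1 / (γ : ℚ)) - 2 := by
  have hb := hpair.generic.brm
  have hhom := hpair.memM.degree.isHomogeneous (i := 0) (j := 1) (by decide)
  obtain ⟨c, hc, hpull⟩ := hpair.exists_pullback_eq hn h𝓕
  obtain ⟨m, hm⟩ := 𝓕.homogeneous
  obtain ⟨k, rfl⟩ := Nat.exists_eq_succ_of_ne_zero (𝓕.pos_of_isHomogeneous hm).ne'
  refine ⟨k, 𝓕.hasDegree_of_isHomogeneous hm, ?_⟩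
  obtain ⟨j, hj⟩ := 𝓕.exists_form_ne_zero
  have h1 := hb.isHomogeneous_pullback hhom j
  have h2 := ((MvPolynomial.IsHomogeneous.prod Finset.univ _ _ fun i _ =>
    (hb.homogeneous i).pow ((![α, β, γ] : Fin 3 → ℕ) i - 1)).mul
      (MvPolynomial.isHomogeneous_C _ c)).mul (hm j)
  rw [← hpull] at h2
  -- Both sides computed by degree: `ν(d+1) + (ν-1) = ∑ (eᵢ - 1) deg Fᵢ + (k+1)`, where `(eᵢ - 1)
  -- deg Fᵢ = ν - deg Fᵢ`.
  have hdeg := h1.inj_right h2 <| by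
    rw [hpull]
    exact mul_ne_zero (mul_ne_zero (Finset.prod_ne_zero_iff.2 fun i _ =>
      pow_ne_zero _ (hb.ne_zero i)) (MvPolynomial.C_ne_zero.2 hc)) hj
  have e0 := hb.degree₀
  have e1 := hb.degree₁
  have e2 := hb.degree₂
  have := hb.one_lt
  have := hb.lt₁
  have := hb.lt₂
  have := hb.two_le
  have hle : ∀ i, (F i).totalDegree ≤ ν := fun i => by
    rw [← hb.totalDegree_mul i]
    exact Nat.le_mul_of_pos_right _ (Nat.pos_of_ne_zero (hb.exponent_ne_zero i))
  have hle0 := hle 0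
  have hle1 := hle 1
  have hle2 := hle 2
  simp only [Fin.sum_univ_three, Matrix.cons_val_zero, Matrix.cons_val_one, Matrix.cons_val,
    Nat.mul_sub, mul_one, add_zero, e0, e1, e2] at hdeg
  zify [hle0, hle1, hle2, (by omega : 1 ≤ ν)] at hdeg
  have hα : (α : ℚ) ≠ 0 := by norm_cast; omega
  have hβ : (β : ℚ) ≠ 0 := by norm_cast; omega
  have hγ : (γ : ℚ) ≠ 0 := by norm_cast; omega
  have q0 : (ν : ℚ) * (1 / α) = (F 0).totalDegree := by
    rw [← e0]; push_cast; field_simp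
  have q1 : (ν : ℚ) * (1 / β) = (F 1).totalDegree := by
    rw [← e1]; push_cast; field_simp
  have q2 : (ν : ℚ) * (1 / γ) = (F 2).totalDegree := by
    rw [← e2]; push_cast; field_simp
  have hdegq : (ν : ℚ) * (d + 1) + (ν - 1) = (ν - (F 0).totalDegree) + (ν - (F 1).totalDegree)
      + (ν - (F 2).totalDegree) + (k + 1) := by exact_mod_cast hdeg
  linear_combination -hdegq - q0 - q1 - q2
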